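/- Let $\Omega$ be the set of infinite naturally labelled causal sets: strict partial orders $\prec$ on $\{0,1,2,\dots\}$ with $i\prec j\Rightarrow i<j$. Let $\Omega_n$ be the finite set of such orders on $\{0,\dots,n-1\}$. For $c\in\Omega_n$ let $\mathrm{cyl}(c)=\{\omega\in\Omega:\omega|_n=c\}$, where $\omega|_n$ is the restriction of $\omega$ to its first $n$ elements. Let $\mathfrak Z$ be the field of subsets of $\Omega$ generated by all cylinder sets. A child of $c\in\Omega_n$ is a $c'\in\Omega_{n+1}$ with $c'|_n=c$. Let $t_0,t_1,\dots\in\mathbb C$, put $\lambda(a,b)=\sum_{k=b}^{a}\binom{a-b}{k-b}t_k$, and assume that $\lambda(n,0)\neq0$ for all $n\ge1$. The complex sequential growth (CSG) dynamics with couplings $t_n$ assigns to the transition from $c\in\Omega_n$, $n\ge1$, to a child $c'$ the amplitude $A(c\to c')=\lambda(\varpi,m)/\lambda(n,0)$, where $\varpi$ is the number of elements, and $m$ the number of maximal elements, of the past of the last element of $c'$. The measure $\mu:\mathfrak Z\to\mathbb C$ is the finitely additive measure with $\mu(\mathrm{cyl}(c))=\prod_{r=1}^{n-1}A(c|_r\to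 c|_{r+1})$ for $c\in\Omega_n$, $n\ge1$. It is of bounded variation if $\sup_\pi\sum_{\alpha\in\pi}|\mu(\alpha)|<\infty$, the supremum being over all finite partitions $\pi$ of $\Omega$ into members of $\mathfrak Z$. For $n\ge1$ let $\zeta_n^a$ and $\zeta_n^c$ be the values of $\sum_{c'}|A(c\to c')|-1$ (sum over the children $c'$ of $c$) at the $n$-element antichain and the $n$-element chain (the total order), respectively. Then for all $n\ge1$ $$\zeta_n^a=\frac{\sum_{k=0}^{n}\binom nk|t_k|}{|\lambda(n,0)|}-1,\qquad \zeta_n^c=\frac{\sum_{\varpi=1}^{n}|\lambda(\varpi,1)|}{|\lambda(n,0)|}+\frac{|\lambda(0,0)|}{|\lambda(n,0)|}-1 .$$ Moreover, $\mu$ is of bounded variation if $\sum_{n=1}^\infty\zeta_n^a$ converges, and $\mu$ is not of bounded variation if $\sum_{n=1}^\infty\zeta_n^c$ does not converge. -/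

import Mathlib

open scoped ENNReal Topology

noncomputable section

namespace CSG

/-- A naturally labelled causal set whose elements are the labels in `α`: a strict partial order
`prec` on `α` such that `i ≺ j` implies `i < j` (this makes `prec` irreflexive). -/
@[ext] structure Causet (α : Type) [LT α] where
  prec : α → α → Prop
  lt_of_prec : ∀ i j, prec i j → i < j
  trans : ∀ i j k, prec i j → prec j k → prec i k

/-- The sample space `Ω` of countable labelled past finite causal sets. Past finiteness is
automatic: the past of the element `j` is contained in `{0, …, j - 1}`. -/
abbrev Omega : Type := Causet ℕ

/-- The set `Ω_n` of `n`-element labelled causal sets: the nodes of poscau at level `n`. -/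
abbrev Node (n : ℕ) : Type := Causet (Fin n)

instance finite_node (n : ℕ) : Finite (Node n) :=
  Finite.of_injective (fun c : Node n => c.prec) fun _ _ h => Causet.ext h

instance fintype_node (n : ℕ) : Fintype (Node n) := Fintype.ofFinite _

/-- `c|_n`: the first `n` elements of an infinite labelled causal set. -/
def Omega.restrict (c : Omega) (n : ℕ) : Node n where
  prec i j := c.prec i j
  lt_of_prec i j h := c.lt_of_prec i j h
  trans i j k h h' := c.trans i j k h h'

/-- The first `m` elements of an `n`-element labelled causal set, `m ≤ n`. -/
def Node.restrict {n : ℕ} (c : Node n) (m : ℕ) (h : m ≤ n) : Node m where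
  prec i j := c.prec (Fin.castLE h i) (Fin.castLE h j)
  lt_of_prec i j hij := c.lt_of_prec (Fin.castLE h i) (Fin.castLE h j) hij
  trans i j k hij hjk := c.trans (Fin.castLE h i) (Fin.castLE h j) (Fin.castLE h k) hij hjk

/-- The parent in poscau of an `(n+1)`-element node. -/
def Node.parent {n : ℕ} (c : Node (n + 1)) : Node n := c.restrict n n.le_succ

open Classical in
/-- The children in poscau of an `n`-element node. -/
def Node.children {n : ℕ} (c : Node n) : Finset (Node (n + 1)) :=
  Finset.univ.filter fun c' => c'.parent = c

/-- The `n`-antichain node. -/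
def antichain (n : ℕ) : Node n where
  prec _ _ := False
  lt_of_prec _ _ h := h.elim
  trans _ _ _ h _ := h

/-- The `n`-chain node. -/
def chain (n : ℕ) : Node n where
  prec i j := i < j
  lt_of_prec _ _ h := h
  trans _ _ _ h h' := lt_trans h h'

open Classical in
/-- The precursor set of the transition `c.parent → c`: the past of the last element of `c`. -/
def Node.precursor {n : ℕ} (c : Node (n + 1)) : Finset (Fin (n + 1)) :=
  Finset.univ.filter fun i => c.prec i (Fin.last n)

open Classical in
/-- The maximal elements of the precursor set. -/
def Node.maxPrecursor {n : ℕ} (c : Node (n + 1)) : Finset (Fin (n + 1)) :=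
  c.precursor.filter fun i => ∀ j ∈ c.precursor, ¬ c.prec i j

/-- `λ(a, b) = ∑_{k=b}^{a} binom(a-b, k-b) t_k`, for `b ≤ a`. -/
def lam (t : ℕ → ℂ) (a b : ℕ) : ℂ :=
  ∑ k ∈ Finset.Icc b a, ((a - b).choose (k - b) : ℂ) * t k

/-- The amplitude `λ(ϖ, m) / λ(n, 0)` of the transition `c.parent → c` from level `n` to level
`n + 1`, with `ϖ` the cardinality of the precursor set and `m` its number of maximal elements. -/
def transAmp (t : ℕ → ℂ) {n : ℕ} (c : Node (n + 1)) : ℂ :=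
  lam t c.precursor.card c.maxPrecursor.card / lam t n 0

/-- The amplitude of a node: the product of the amplitudes of the transitions
`c|_m → c|_{m+1}`, `1 ≤ m < n`, along its branch, which starts at the one-element node. -/
def nodeAmp (t : ℕ → ℂ) {n : ℕ} (c : Node n) : ℂ :=
  ∏ m : Fin n, if 1 ≤ (m : ℕ) then transAmp t (c.restrict (m + 1) m.isLt) else 1

/-- The cylinder set of a node. -/
def cyl {n : ℕ} (c : Node n) : Set Omega := {ω | ω.restrict n = c}

/-- The event algebra: the field of subsets of `Ω` generated by the cylinder sets. -/
def eventAlgebra : Set (Set Omega) :=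
  MeasureTheory.generateSetAlgebra {A | ∃ (n : ℕ) (c : Node n), A = cyl c}

/-- The least `n` such that `A` is a union of cylinder sets of `n`-element nodes (such an `n` exists
for every event of the event algebra). -/
def level (A : Set Omega) : ℕ := sInf {n | ∃ S : Set (Node n), A = ⋃ c ∈ S, cyl c}

open Classical in
/-- The complex measure of an event `A`: the sum of the amplitudes of the nodes of its fine
partition, i.e. of the `n`-element nodes whose cylinder sets make up `A`, with `n = level A`.
(It is used only on the event algebra.) -/
def measure (t : ℕ → ℂ) (A : Set Omega) : ℂ :=
  ∑ c : Node (level A), if cyl c ⊆ A then nodeAmp t c else 0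

/-- `P` is a finite partition of `A` into events of the event algebra. -/
def IsEventPartition (P : Finset (Set Omega)) (A : Set Omega) : Prop :=
  (∀ B ∈ P, B ∈ eventAlgebra) ∧ (P : Set (Set Omega)).PairwiseDisjoint id ∧
    ⋃₀ (P : Set (Set Omega)) = A

/-- The variation `|μ|(A)`: the supremum of `∑ |μ(A_i)|` over the finite partitions of `A` into
events. -/
def variation (μ : Set Omega → ℂ) (A : Set Omega) : ℝ≥0∞ :=
  ⨆ (P : Finset (Set Omega)) (_ : IsEventPartition P A), ∑ B ∈ P, ‖μ B‖ₑ

/-- Bounded variation: `|μ|(Ω) < ∞`. -/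
def HasBoundedVariation (μ : Set Omega → ℂ) : Prop := variation μ Set.univ < ∞

/-- `ζ` at a node: `∑ |A(c → c')| - 1`, summed over the children `c'` of `c`. -/
def zeta (t : ℕ → ℂ) {n : ℕ} (c : Node n) : ℝ :=
  (∑ c' ∈ c.children, ‖transAmp t c'‖) - 1

/-- The explicit expression `ζ_n^a`. -/
def zetaA (t : ℕ → ℂ) (n : ℕ) : ℝ :=
  (∑ k ∈ Finset.range (n + 1), (n.choose k : ℝ) * ‖t k‖) / ‖lam t n 0‖ - 1

/-- The explicit expression `ζ_n^c`. -/
def zetaC (t : ℕ → ℂ) (n : ℕ) : ℝ :=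
  (∑ p ∈ Finset.Icc 1 n, ‖lam t p 1‖) / ‖lam t n 0‖ + ‖lam t 0 0‖ / ‖lam t n 0‖ - 1

/-- The series `∑_{n=1}^∞ u_n` converges: its partial sums have a (finite) limit. -/
def SeriesConverges (u : ℕ → ℝ) : Prop :=
  ∃ l : ℝ, Filter.Tendsto (fun N : ℕ => ∑ n ∈ Finset.Icc 1 N, u n) Filter.atTop (𝓝 l)

end CSG

end

namespace CSG

/-! Every subset `S` of an `n`-element node generates a child, in which the past of the new element
is the down-closure of `S`. The unnormalised amplitude of a child is the sum of `t S.card` over the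
sets generating it, so each `zeta` measures the cancellation inside these fibres. In the antichain
the fibres are singletons and nothing cancels, so `zetaA` is an upper bound for `zeta` at every
node. Grouping the sets by largest label is coarser than grouping by child, and for the chain it is
the same grouping, so `zetaC` is a lower bound. Hence `absSum` grows from level `n` to `n + 1` by a
factor between `1 + zetaC t n` and `1 + zetaA t n`. The variation is controlled by these level sums:
cylinder partitions attain them, and every finite event partition is bounded by one of them. -/

theorem sum_Icc_card {α : Type*} [DecidableEq α] (t : ℕ → ℂ) {M D : Finset α} (h : M ⊆ D) :
    ∑ S ∈ Finset.Icc M D, t S.card = lam t D.card M.card := by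
  have hdisj : ∀ S ∈ (D \ M).powerset, Disjoint M S := fun S hS =>
    Finset.disjoint_of_subset_right (Finset.mem_powerset.mp hS) Finset.disjoint_sdiff
  rw [Finset.Icc_eq_image_powerset h, Finset.sum_image]
  · rw [Finset.sum_congr rfl fun S hS => by rw [Finset.card_union_of_disjoint (hdisj S hS)],
      Finset.sum_powerset_apply_card (fun k => t (M.card + k)), Finset.card_sdiff_of_subset h, lam,
      ← Finset.Ico_add_one_right_eq_Icc, Finset.sum_Ico_eq_sum_range,
      Nat.sub_add_comm (Finset.card_le_card h)]
    exact Finset.sum_congr rfl fun k _ => by rw [nsmul_eq_mul, Nat.add_sub_cancel_left]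
  · intro S hS T hT hST
    have h1 := Finset.union_sdiff_cancel_left (hdisj S hS)
    have h2 := Finset.union_sdiff_cancel_left (hdisj T hT)
    simp only at hST
    rw [← h1, hST, h2]

theorem sum_card_eq_lam (t : ℕ → ℂ) (n : ℕ) : ∑ S : Finset (Fin n), t S.card = lam t n 0 := by
  have h := sum_Icc_card t (Finset.empty_subset (Finset.univ : Finset (Fin n)))
  rw [Finset.card_univ, Fintype.card_fin, Finset.card_empty] at h
  rw [← h]
  congr 1
  ext S
  simp

theorem Causet.irrefl {α : Type} [Preorder α] (c : Causet α) (i : α) : ¬ c.prec i i :=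
  fun h => lt_irrefl i (c.lt_of_prec i i h)

/-! ### Children generated by subsets -/

namespace Node

variable {n : ℕ}

/-- The child of `c` in which the past of the new element is the down-closure of `S`. -/
def child (c : Node n) (S : Finset (Fin n)) : Node (n + 1) where
  prec i j := ∃ i' : Fin n, i'.castSucc = i ∧
    ((∃ j' : Fin n, j'.castSucc = j ∧ c.prec i' j') ∨
      j = Fin.last n ∧ ∃ s ∈ S, i' = s ∨ c.prec i' s)
  lt_of_prec := by
    rintro _ _ ⟨i, rfl, ⟨j, rfl, h⟩ | ⟨rfl, -⟩⟩
    · exact c.lt_of_prec i j h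
    · exact i.castSucc_lt_last
  trans := by
    rintro _ _ k ⟨i, rfl, ⟨j, rfl, h⟩ | ⟨rfl, -⟩⟩ ⟨j', hj, h'⟩
    · obtain rfl := Fin.castSucc_injective n hj
      refine ⟨i, rfl, ?_⟩
      rcases h' with ⟨k, rfl, h'⟩ | ⟨rfl, s, hs, rfl | h'⟩
      · exact Or.inl ⟨k, rfl, c.trans _ _ _ h h'⟩
      · exact Or.inr ⟨rfl, _, hs, Or.inr h⟩
      · exact Or.inr ⟨rfl, s, hs, Or.inr (c.trans _ _ _ h h')⟩
    · exact absurd hj (Fin.castSucc_ne_last j')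

theorem parent_prec (c : Node (n + 1)) (i j : Fin n) :
    c.parent.prec i j ↔ c.prec i.castSucc j.castSucc := Iff.rfl

theorem child_prec_castSucc (c : Node n) (S : Finset (Fin n)) (i j : Fin n) :
    (c.child S).prec i.castSucc j.castSucc ↔ c.prec i j := by
  constructor
  · rintro ⟨i', hi, ⟨j', hj, h⟩ | ⟨h, -⟩⟩
    · obtain rfl := Fin.castSucc_injective n hi
      obtain rfl := Fin.castSucc_injective n hj
      exact h
    · exact absurd h (Fin.castSucc_ne_last j)
  · exact fun h => ⟨i, rfl, Or.inl ⟨j, rfl, h⟩⟩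

theorem child_prec_last (c : Node n) (S : Finset (Fin n)) (i : Fin n) :
    (c.child S).prec i.castSucc (Fin.last n) ↔ ∃ s ∈ S, i = s ∨ c.prec i s := by
  constructor
  · rintro ⟨i', hi, ⟨j', hj, h⟩ | ⟨-, h⟩⟩
    · exact absurd hj (Fin.castSucc_ne_last j')
    · obtain rfl := Fin.castSucc_injective n hi
      exact h
  · exact fun h => ⟨i, rfl, Or.inr ⟨rfl, h⟩⟩

theorem parent_child (c : Node n) (S : Finset (Fin n)) : (c.child S).parent = c :=
  Causet.ext <| funext₂ fun i j => propext <| child_prec_castSucc c S i j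

theorem mem_children {c : Node n} {c' : Node (n + 1)} : c' ∈ c.children ↔ c'.parent = c := by
  simp [children]

theorem child_mem_children (c : Node n) (S : Finset (Fin n)) : c.child S ∈ c.children :=
  mem_children.mpr (parent_child c S)

/-- A node is determined by its parent and the past of its last element. -/
theorem ext_parent {c d : Node (n + 1)} (h : c.parent = d.parent)
    (hl : ∀ i : Fin n, c.prec i.castSucc (Fin.last n) ↔ d.prec i.castSucc (Fin.last n)) :
    c = d := by
  refine Causet.ext <| funext₂ fun i j => propext ?_
  induction i using Fin.lastCases with
  | last =>
    exact ⟨fun h => absurd (c.lt_of_prec _ _ h) (Fin.le_last j).not_gt,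
      fun h => absurd (d.lt_of_prec _ _ h) (Fin.le_last j).not_gt⟩
  | cast i =>
    induction j using Fin.lastCases with
    | last => exact hl i
    | cast j => rw [← parent_prec, ← parent_prec, h]

theorem mem_precursor {c : Node (n + 1)} {i : Fin (n + 1)} :
    i ∈ c.precursor ↔ c.prec i (Fin.last n) := by
  simp [precursor]

theorem mem_maxPrecursor {c : Node (n + 1)} {i : Fin (n + 1)} :
    i ∈ c.maxPrecursor ↔ c.prec i (Fin.last n) ∧
      ∀ j, c.prec j (Fin.last n) → ¬ c.prec i j := by
  simp [maxPrecursor, mem_precursor]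

theorem maxPrecursor_subset (c : Node (n + 1)) : c.maxPrecursor ⊆ c.precursor := by
  simp [maxPrecursor]

/-- Every element of the precursor set lies below, or is, a maximal one. -/
theorem exists_maxPrecursor (c : Node (n + 1)) {i : Fin (n + 1)} (hi : c.prec i (Fin.last n)) :
    ∃ j ∈ c.maxPrecursor, i = j ∨ c.prec i j := by
  induction i using WellFoundedGT.induction with
  | ind i ih =>
    by_cases hm : i ∈ c.maxPrecursor
    · exact ⟨i, hm, Or.inl rfl⟩
    · rw [mem_maxPrecursor] at hm
      push Not at hm
      obtain ⟨k, hk, hik⟩ := hm hi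
      obtain ⟨j, hj, h⟩ := ih k (c.lt_of_prec _ _ hik) hk
      refine ⟨j, hj, Or.inr ?_⟩
      rcases h with rfl | h
      · exact hik
      · exact c.trans _ _ _ hik h

/-- A maximal element of the past lies below no other element of it, so a generating set must
contain it; conversely the maximal elements alone generate the past. -/
theorem child_parent_eq_iff (c : Node (n + 1)) (S : Finset (Fin n)) :
    c.parent.child S = c ↔ S.map Fin.castSuccEmb ∈ Finset.Icc c.maxPrecursor c.precursor := by
  rw [Finset.mem_Icc]
  constructor
  · intro h
    have hl : ∀ i : Fin n, c.prec i.castSucc (Fin.last n) ↔ ∃ s ∈ S, i = s ∨ c.parent.prec i s :=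
      fun i => by rw [← child_prec_last, h]
    constructor
    · intro i hi
      rw [mem_maxPrecursor] at hi
      induction i using Fin.lastCases with
      | last => exact absurd hi.1 (c.irrefl _)
      | cast i =>
        obtain ⟨s, hs, rfl | h'⟩ := (hl i).mp hi.1
        · exact Finset.mem_map_of_mem _ hs
        · exact absurd h' (hi.2 _ ((hl s).mpr ⟨s, hs, Or.inl rfl⟩))
    · intro i hi
      obtain ⟨s, hs, rfl⟩ := Finset.mem_map.mp hi
      exact mem_precursor.mpr ((hl s).mpr ⟨s, hs, Or.inl rfl⟩)
  · rintro ⟨hM, hD⟩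
    refine ext_parent (parent_child _ _) fun i => ?_
    rw [child_prec_last]
    have hS : ∀ s ∈ S, c.prec s.castSucc (Fin.last n) := fun s hs =>
      mem_precursor.mp (hD (Finset.mem_map_of_mem _ hs))
    constructor
    · rintro ⟨s, hs, rfl | h⟩
      · exact hS _ hs
      · exact c.trans _ _ _ h (hS s hs)
    · intro hi
      obtain ⟨j, hj, h⟩ := exists_maxPrecursor c hi
      obtain ⟨s, hs, rfl⟩ := Finset.mem_map.mp (hM hj)
      exact ⟨s, hs, h.imp (fun h => Fin.castSucc_injective n h) id⟩

open Classical in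
/-- The amplitude of a transition, before normalisation, is the sum of the couplings over the
sets that generate its precursor set. -/
theorem sum_filter_child (t : ℕ → ℂ) {c : Node n} {c' : Node (n + 1)} (h : c' ∈ c.children) :
    ∑ S : Finset (Fin n) with c.child S = c', t S.card =
      lam t c'.precursor.card c'.maxPrecursor.card := by
  obtain rfl := mem_children.mp h
  rw [← sum_Icc_card t c'.maxPrecursor_subset]
  refine Finset.sum_bij (fun S _ => S.map Fin.castSuccEmb) ?_ ?_ ?_ ?_
  · exact fun S hS => (child_parent_eq_iff c' S).mp (Finset.mem_filter.mp hS).2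
  · exact fun S _ T _ hST => Finset.map_injective _ hST
  · intro T hT
    -- Irreflexivity keeps the last element out of `T`, so `T` comes from a subset of the parent.
    have hlast : ∀ i ∈ T, i ≠ Fin.last n := fun i hi h =>
      c'.irrefl _ (h ▸ mem_precursor.mp ((Finset.mem_Icc.mp hT).2 hi))
    have hmap : (Finset.univ.filter fun i : Fin n => i.castSucc ∈ T).map Fin.castSuccEmb = T := by
      ext i
      induction i using Fin.lastCases with
      | last => simpa using fun h => hlast _ h rfl
      | cast i => simp
    refine ⟨_, Finset.mem_filter.mpr ⟨Finset.mem_univ _, ?_⟩, hmap⟩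
    rw [child_parent_eq_iff, hmap]
    exact hT
  · exact fun S _ => by rw [Finset.card_map]

/-- The past of the new element is already down-closed, so it generates itself. -/
theorem exists_child_eq {c : Node n} {c' : Node (n + 1)} (h : c' ∈ c.children) :
    ∃ S, c.child S = c' := by
  classical
  obtain rfl := mem_children.mp h
  refine ⟨Finset.univ.filter fun i : Fin n => c'.prec i.castSucc (Fin.last n),
    ext_parent (parent_child _ _) fun i => ?_⟩
  rw [child_prec_last]
  constructor
  · rintro ⟨s, hs, rfl | h⟩
    · exact (Finset.mem_filter.mp hs).2
    · exact c'.trans _ _ _ h (Finset.mem_filter.mp hs).2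
  · exact fun h => ⟨i, by simpa using h, Or.inl rfl⟩

theorem sum_children_lam (t : ℕ → ℂ) (c : Node n) :
    ∑ c' ∈ c.children, lam t c'.precursor.card c'.maxPrecursor.card = lam t n 0 := by
  classical
  rw [← sum_card_eq_lam, ← Finset.sum_fiberwise_of_maps_to fun S _ => child_mem_children c S]
  exact Finset.sum_congr rfl fun c' hc' => (sum_filter_child t hc').symm

/-- The Markov sum rule. -/
theorem sum_children_transAmp (t : ℕ → ℂ) (ht : lam t n 0 ≠ 0) (c : Node n) :
    ∑ c' ∈ c.children, transAmp t c' = 1 := by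
  simp only [transAmp]
  rw [← Finset.sum_div, sum_children_lam, div_self ht]

theorem zeta_eq (t : ℕ → ℂ) (c : Node n) :
    zeta t c = (∑ c' ∈ c.children, ‖lam t c'.precursor.card c'.maxPrecursor.card‖) /
      ‖lam t n 0‖ - 1 := by
  simp only [zeta, transAmp, norm_div, Finset.sum_div]

theorem zeta_nonneg (t : ℕ → ℂ) (ht : lam t n 0 ≠ 0) (c : Node n) : 0 ≤ zeta t c := by
  rw [zeta, sub_nonneg, ← norm_one (α := ℂ), ← sum_children_transAmp t ht c]
  exact norm_sum_le _ _

/-! ### Upper bound, attained at the antichain -/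

theorem zetaA_eq (t : ℕ → ℂ) (n : ℕ) :
    zetaA t n = (∑ S : Finset (Fin n), ‖t S.card‖) / ‖lam t n 0‖ - 1 := by
  have h := Finset.sum_powerset_apply_card (fun k => ‖t k‖) (x := (Finset.univ : Finset (Fin n)))
  rw [Finset.powerset_univ, Finset.card_univ, Fintype.card_fin] at h
  simp only [zetaA, h, nsmul_eq_mul]

/-- Triangle inequality on each fibre of `c.child`. -/
theorem zeta_le_zetaA (t : ℕ → ℂ) (c : Node n) : zeta t c ≤ zetaA t n := by
  classical
  rw [zeta_eq, zetaA_eq, ← Finset.sum_fiberwise_of_maps_to fun S _ => child_mem_children c S]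
  gcongr with c' hc'
  rw [← sum_filter_child t hc']
  exact norm_sum_le _ _

theorem antichain_child_injective (n : ℕ) : Function.Injective (antichain n).child := by
  intro S T h
  ext i
  have key : ∀ U : Finset (Fin n),
      ((antichain n).child U).prec i.castSucc (Fin.last n) ↔ i ∈ U := fun U => by
    rw [child_prec_last]
    simp [antichain]
  rw [← key, h, key]

theorem zeta_antichain (t : ℕ → ℂ) (n : ℕ) : zeta t (antichain n) = zetaA t n := by
  classical
  rw [zeta_eq, zetaA_eq,
    ← Finset.sum_fiberwise_of_maps_to fun S _ => child_mem_children (antichain n) S]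
  congr 2
  refine Finset.sum_congr rfl fun c' hc' => ?_
  rw [← sum_filter_child t hc']
  obtain ⟨S, rfl⟩ := exists_child_eq hc'
  have h : (Finset.univ.filter fun T => (antichain n).child T = (antichain n).child S) = {S} := by
    ext T
    simp [(antichain_child_injective n).eq_iff]
  rw [h, Finset.sum_singleton, Finset.sum_singleton]

/-! ### Lower bound, attained at the chain -/

/-- One more than the largest label in a set, and `0` for the empty set. -/
def height (S : Finset (Fin n)) : ℕ := S.sup fun i => (i : ℕ) + 1

theorem height_le_iff {S : Finset (Fin n)} {p : ℕ} : height S ≤ p ↔ ∀ i ∈ S, (i : ℕ) < p := by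
  simp [height, Finset.sup_le_iff]

theorem height_mem_range (S : Finset (Fin n)) : height S ∈ Finset.range (n + 1) :=
  Finset.mem_range_succ_iff.mpr (height_le_iff.mpr fun i _ => i.isLt)

open Classical in
/-- The elements of the parent in the precursor set. -/
noncomputable def past (c : Node (n + 1)) : Finset (Fin n) :=
  Finset.univ.filter fun i => c.prec i.castSucc (Fin.last n)

theorem mem_past {c : Node (n + 1)} {i : Fin n} :
    i ∈ c.past ↔ c.prec i.castSucc (Fin.last n) := by
  simp [past]

/-- Labels increase along the order, so taking the down-closure cannot raise the largest label. -/
theorem height_past_child (c : Node n) (S : Finset (Fin n)) :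
    height (c.child S).past = height S := by
  refine eq_of_forall_ge_iff fun p => ?_
  simp only [height_le_iff, mem_past, child_prec_last]
  constructor
  · exact fun h i hi => h i ⟨i, hi, Or.inl rfl⟩
  · rintro h i ⟨s, hs, rfl | his⟩
    · exact h _ hs
    · exact (Fin.lt_def.mp (c.lt_of_prec _ _ his)).trans (h s hs)

theorem sum_height_zero (t : ℕ → ℂ) (n : ℕ) :
    ∑ S : Finset (Fin n) with height S = 0, t S.card = lam t 0 0 := by
  have h : (Finset.univ.filter fun S : Finset (Fin n) => height S = 0) = {∅} := by
    ext S
    rw [Finset.mem_filter, ← Nat.le_zero, height_le_iff, Finset.mem_singleton,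
      Finset.eq_empty_iff_forall_notMem]
    simp
  rw [h, Finset.sum_singleton, lam]
  simp

/-- The sets with largest label `p` form the interval from `{p}` to `{0, …, p}`. -/
theorem sum_height_succ (t : ℕ → ℂ) {n p : ℕ} (hp : p < n) :
    ∑ S : Finset (Fin n) with height S = p + 1, t S.card = lam t (p + 1) 1 := by
  have h := sum_Icc_card t
    (Finset.singleton_subset_iff.mpr (Finset.mem_Iic.mpr (le_refl (⟨p, hp⟩ : Fin n))))
  rw [Fin.card_Iic, Finset.card_singleton] at h
  rw [← h]
  congr 1
  ext S
  rw [Finset.mem_filter, Finset.mem_Icc, Finset.singleton_subset_iff]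
  simp only [Finset.mem_univ, true_and, Finset.subset_iff, Finset.mem_Iic, Fin.le_def]
  have h1 := height_le_iff (S := S) (p := p + 1)
  have h2 := height_le_iff (S := S) (p := p)
  constructor
  · intro hS
    refine ⟨?_, fun i hi => Nat.lt_succ_iff.mp (h1.mp hS.le i hi)⟩
    by_contra hpS
    have : height S ≤ p := h2.mpr fun i hi =>
      lt_of_le_of_ne (Nat.lt_succ_iff.mp (h1.mp hS.le i hi)) fun hip =>
        hpS (by rwa [show (⟨p, hp⟩ : Fin n) = i from Fin.ext hip.symm])
    omega
  · rintro ⟨hpS, hS⟩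
    refine le_antisymm (h1.mpr fun i hi => Nat.lt_succ_iff.mpr (hS hi)) ?_
    by_contra hlt
    exact lt_irrefl p (h2.mp (by omega) _ hpS)

theorem zetaC_eq (t : ℕ → ℂ) (n : ℕ) :
    zetaC t n = (∑ p ∈ Finset.range (n + 1),
      ‖∑ S : Finset (Fin n) with height S = p, t S.card‖) / ‖lam t n 0‖ - 1 := by
  rw [zetaC, Finset.sum_range_succ', sum_height_zero, add_div,
    ← Finset.Ico_add_one_right_eq_Icc, Finset.sum_Ico_eq_sum_range]
  congr 3
  refine Finset.sum_congr rfl fun p hp => ?_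
  rw [sum_height_succ t (Finset.mem_range.mp hp), add_comm]

open Classical in
-- Height factors through the generated child, so each height class is a union of fibres of
-- `c.child`.
theorem sum_height_eq_sum_children (t : ℕ → ℂ) (c : Node n) (p : ℕ) :
    ∑ S : Finset (Fin n) with height S = p, t S.card =
      ∑ c' ∈ c.children with height c'.past = p,
        lam t c'.precursor.card c'.maxPrecursor.card := by
  rw [← Finset.sum_fiberwise_of_maps_to (g := c.child)
    (t := c.children.filter fun c' => height c'.past = p)]
  · refine Finset.sum_congr rfl fun c' hc' => ?_
    rw [Finset.mem_filter] at hc'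
    rw [← sum_filter_child t hc'.1, Finset.filter_filter]
    refine Finset.sum_congr (Finset.filter_congr fun S _ => ?_) fun _ _ => rfl
    refine ⟨And.right, fun h => ⟨?_, h⟩⟩
    rw [← height_past_child c, h, hc'.2]
  · intro S hS
    rw [Finset.mem_filter] at hS ⊢
    exact ⟨child_mem_children c S, by rw [height_past_child, hS.2]⟩

theorem zetaC_le_zeta (t : ℕ → ℂ) (c : Node n) : zetaC t n ≤ zeta t c := by
  classical
  rw [zeta_eq, zetaC_eq, ← Finset.sum_fiberwise_of_maps_to (g := fun c' : Node (n + 1) => height c'.past)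
    (t := Finset.range (n + 1)) fun c' _ => height_mem_range _]
  gcongr with p hp
  rw [sum_height_eq_sum_children t c]
  exact norm_sum_le _ _

/-- A down-set of a chain is an initial segment, determined by its height. -/
theorem chain_children_eq {c d : Node (n + 1)} (hc : c ∈ (chain n).children)
    (hd : d ∈ (chain n).children) (h : height c.past = height d.past) : c = d := by
  have key : ∀ e ∈ (chain n).children, ∀ i : Fin n,
      e.prec i.castSucc (Fin.last n) ↔ ¬ height e.past ≤ i := by
    intro e he i
    rw [height_le_iff]
    push Not
    constructor
    · exact fun hi => ⟨i, mem_past.mpr hi, le_rfl⟩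
    · rintro ⟨j, hj, hij⟩
      rw [mem_past] at hj
      rcases hij.eq_or_lt with hij | hij
      · rwa [Fin.ext hij]
      · refine e.trans _ _ _ ?_ hj
        rw [← parent_prec, mem_children.mp he]
        exact hij
  refine ext_parent ((mem_children.mp hc).trans (mem_children.mp hd).symm) fun i => ?_
  rw [key c hc, key d hd, h]

theorem zeta_chain (t : ℕ → ℂ) (n : ℕ) : zeta t (chain n) = zetaC t n := by
  classical
  rw [zeta_eq, zetaC_eq, ← Finset.sum_fiberwise_of_maps_to (g := fun c' : Node (n + 1) => height c'.past)
    (t := Finset.range (n + 1)) fun c' _ => height_mem_range _]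
  congr 2
  refine Finset.sum_congr rfl fun p _ => ?_
  rw [sum_height_eq_sum_children t (chain n)]
  rcases Finset.eq_empty_or_nonempty
    ((chain n).children.filter fun c' => height c'.past = p) with h | ⟨c, hc⟩
  · simp [h]
  · have : ((chain n).children.filter fun c' => height c'.past = p) = {c} := by
      refine Finset.eq_singleton_iff_unique_mem.mpr ⟨hc, fun d hd => ?_⟩
      rw [Finset.mem_filter] at hc hd
      exact chain_children_eq hd.1 hc.1 (hd.2.trans hc.2.symm)
    simp [this]

end Node

/-! ### Node amplitudes and level sums -/

namespace Node

variable {n : ℕ}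

theorem nodeAmp_succ (t : ℕ → ℂ) (c : Node (n + 1)) :
    nodeAmp t c = nodeAmp t c.parent * if 1 ≤ n then transAmp t c else 1 := by
  rw [nodeAmp, Fin.prod_univ_castSucc]
  rfl

theorem nodeAmp_zero (t : ℕ → ℂ) (c : Node 0) : nodeAmp t c = 1 := by
  rw [nodeAmp, Fin.prod_univ_zero]

instance uniqueZero : Unique (Node 0) where
  default := antichain 0
  uniq _ := Causet.ext <| funext fun i => i.elim0

instance uniqueOne : Unique (Node 1) where
  default := antichain 1
  uniq c := Causet.ext <| funext₂ fun i j => by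
    obtain rfl := Subsingleton.elim i j
    exact propext ⟨fun h => c.irrefl i h, False.elim⟩

theorem sum_eq_sum_children {M : Type*} [AddCommMonoid M] (f : Node (n + 1) → M) :
    ∑ c', f c' = ∑ c : Node n, ∑ c' ∈ c.children, f c' := by
  classical
  rw [← Finset.sum_fiberwise Finset.univ Node.parent]
  refine Finset.sum_congr rfl fun c _ => Finset.sum_congr ?_ fun _ _ => rfl
  ext c'
  simp [mem_children]

/-- The sum of the amplitudes of the children of a node is its own amplitude. -/
theorem sum_children_nodeAmp (t : ℕ → ℂ) (ht : ∀ n, 1 ≤ n → lam t n 0 ≠ 0) (c : Node n) :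
    ∑ c' ∈ c.children, nodeAmp t c' = nodeAmp t c := by
  -- Level 0 is separate because `lam t 0 0` may vanish; the only transition there carries the
  -- factor 1.
  rcases Nat.eq_zero_or_pos n with rfl | hn
  · have h : c.children = {antichain 1} := by
      ext c'
      rw [mem_children, Finset.mem_singleton]
      exact iff_of_true (Subsingleton.elim _ _) (Subsingleton.elim (α := Node 1) _ _)
    rw [h, Finset.sum_singleton, nodeAmp_succ, nodeAmp_zero, nodeAmp_zero]
    simp
  · rw [← mul_one (nodeAmp t c), ← sum_children_transAmp t (ht n hn) c, Finset.mul_sum]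
    refine Finset.sum_congr rfl fun c' hc' => ?_
    rw [nodeAmp_succ, mem_children.mp hc', if_pos (Nat.succ_le_of_lt hn)]

end Node

/-- The sum of the absolute values of the amplitudes of the nodes at level `n`. -/
noncomputable def absSum (t : ℕ → ℂ) (n : ℕ) : ℝ := ∑ c : Node n, ‖nodeAmp t c‖

theorem absSum_nonneg (t : ℕ → ℂ) (n : ℕ) : 0 ≤ absSum t n :=
  Finset.sum_nonneg fun _ _ => norm_nonneg _

theorem absSum_one (t : ℕ → ℂ) : absSum t 1 = 1 := by
  rw [absSum, Fintype.sum_unique, Node.nodeAmp_succ, Node.nodeAmp_zero]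
  simp

theorem absSum_succ (t : ℕ → ℂ) {n : ℕ} (hn : 1 ≤ n) :
    absSum t (n + 1) = ∑ c : Node n, ‖nodeAmp t c‖ * (1 + zeta t c) := by
  rw [absSum, Node.sum_eq_sum_children]
  refine Finset.sum_congr rfl fun c _ => ?_
  rw [zeta, add_sub_cancel, Finset.mul_sum]
  refine Finset.sum_congr rfl fun c' hc' => ?_
  rw [Node.nodeAmp_succ, if_pos hn, norm_mul, Node.mem_children.mp hc']

theorem absSum_succ_le (t : ℕ → ℂ) {n : ℕ} (hn : 1 ≤ n) :
    absSum t (n + 1) ≤ absSum t n * (1 + zetaA t n) := by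
  rw [absSum_succ t hn, absSum, Finset.sum_mul]
  gcongr with c
  exact c.zeta_le_zetaA t

theorem le_absSum_succ (t : ℕ → ℂ) {n : ℕ} (hn : 1 ≤ n) :
    absSum t n * (1 + zetaC t n) ≤ absSum t (n + 1) := by
  rw [absSum_succ t hn, absSum, Finset.sum_mul]
  gcongr with c
  exact c.zetaC_le_zeta t

/-- Iterates the growth bound, using `1 + x ≤ exp x`. -/
theorem absSum_le_exp (t : ℕ → ℂ) (N : ℕ) :
    absSum t (N + 1) ≤ Real.exp (∑ n ∈ Finset.Icc 1 N, zetaA t n) := by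
  induction N with
  | zero => simp [absSum_one]
  | succ N ih =>
    rw [Finset.sum_Icc_succ_top (Nat.le_add_left 1 N), Real.exp_add]
    refine (absSum_succ_le t (Nat.le_add_left 1 N)).trans ?_
    refine mul_le_mul_of_nonneg ih ?_ (absSum_nonneg t _) (Real.exp_pos _).le
    rw [add_comm]
    exact Real.add_one_le_exp _

theorem zetaA_nonneg (t : ℕ → ℂ) {n : ℕ} (ht : lam t n 0 ≠ 0) : 0 ≤ zetaA t n := by
  rw [← Node.zeta_antichain]
  exact Node.zeta_nonneg t ht _

theorem zetaC_nonneg (t : ℕ → ℂ) {n : ℕ} (ht : lam t n 0 ≠ 0) : 0 ≤ zetaC t n := by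
  rw [← Node.zeta_chain]
  exact Node.zeta_nonneg t ht _

theorem one_add_sum_le_absSum (t : ℕ → ℂ) (ht : ∀ n, 1 ≤ n → lam t n 0 ≠ 0) (N : ℕ) :
    1 + ∑ n ∈ Finset.Icc 1 N, zetaC t n ≤ absSum t (N + 1) := by
  induction N with
  | zero => simp [absSum_one]
  | succ N ih =>
    rw [Finset.sum_Icc_succ_top (Nat.le_add_left 1 N)]
    have h0 : 0 ≤ ∑ n ∈ Finset.Icc 1 N, zetaC t n :=
      Finset.sum_nonneg fun n hn => zetaC_nonneg t (ht n (Finset.mem_Icc.mp hn).1)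
    have h1 := zetaC_nonneg t (ht (N + 1) (Nat.le_add_left 1 N))
    have h2 := le_absSum_succ t (Nat.le_add_left 1 N)
    nlinarith

theorem monotone_sum_Icc {u : ℕ → ℝ} (hu : ∀ n, 1 ≤ n → 0 ≤ u n) :
    Monotone fun N => ∑ n ∈ Finset.Icc 1 N, u n := fun _ _ h =>
  Finset.sum_le_sum_of_subset_of_nonneg (Finset.Icc_subset_Icc_right h) fun n hn _ =>
    hu n (Finset.mem_Icc.mp hn).1

/-! ### Cylinder sets, events and their measure -/

/-- A node extended by elements that are unrelated to all others. -/
def Node.extend {n : ℕ} (c : Node n) : Omega where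
  prec i j := ∃ (hi : i < n) (hj : j < n), c.prec ⟨i, hi⟩ ⟨j, hj⟩
  lt_of_prec := fun _ _ ⟨_, _, h⟩ => c.lt_of_prec _ _ h
  trans := fun _ _ _ ⟨hi, _, h⟩ ⟨_, hk, h'⟩ => ⟨hi, hk, c.trans _ _ _ h h'⟩

theorem Node.restrict_extend {n : ℕ} (c : Node n) : c.extend.restrict n = c :=
  Causet.ext <| funext₂ fun i j => propext ⟨fun ⟨_, _, h⟩ => h, fun h => ⟨i.2, j.2, h⟩⟩

theorem mem_cyl {n : ℕ} {c : Node n} {ω : Omega} : ω ∈ cyl c ↔ ω.restrict n = c := Iff.rfl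

/-- Cylinders are nonempty, as witnessed by `Node.extend`. -/
theorem cyl_injective (n : ℕ) : Function.Injective (cyl : Node n → Set Omega) := by
  intro c d h
  have hc : c.extend ∈ cyl c := c.restrict_extend
  rw [h, mem_cyl, c.restrict_extend] at hc
  exact hc

/-- `A` is a union of cylinder sets of `n`-element nodes. -/
def IsUnionCyl (n : ℕ) (A : Set Omega) : Prop := ∃ S : Set (Node n), A = ⋃ c ∈ S, cyl c

theorem mem_iUnion_cyl {n : ℕ} {S : Set (Node n)} {ω : Omega} :
    ω ∈ ⋃ c ∈ S, cyl c ↔ ω.restrict n ∈ S := by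
  simp [mem_cyl]

theorem cyl_subset_iUnion_iff {n : ℕ} {S : Set (Node n)} {c : Node n} :
    cyl c ⊆ ⋃ d ∈ S, cyl d ↔ c ∈ S := by
  constructor
  · intro h
    have hc := mem_iUnion_cyl.mp (h (mem_cyl.mpr c.restrict_extend))
    rwa [c.restrict_extend] at hc
  · exact fun h => Set.subset_biUnion_of_mem h

namespace IsUnionCyl

variable {n : ℕ} {A B : Set Omega}

theorem succ (h : IsUnionCyl n A) : IsUnionCyl (n + 1) A := by
  obtain ⟨S, rfl⟩ := h
  refine ⟨Node.parent ⁻¹' S, Set.ext fun ω => ?_⟩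
  rw [mem_iUnion_cyl, mem_iUnion_cyl]
  rfl

theorem mono {m : ℕ} (h : IsUnionCyl n A) (hnm : n ≤ m) : IsUnionCyl m A := by
  induction m, hnm using Nat.le_induction with
  | base => exact h
  | succ m _ ih => exact ih.succ

theorem of_cyl (c : Node n) : IsUnionCyl n (cyl c) := ⟨{c}, by simp⟩

theorem compl (h : IsUnionCyl n A) : IsUnionCyl n Aᶜ := by
  obtain ⟨S, rfl⟩ := h
  refine ⟨Sᶜ, Set.ext fun ω => ?_⟩
  rw [Set.mem_compl_iff, mem_iUnion_cyl, mem_iUnion_cyl, Set.mem_compl_iff]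

theorem union (hA : IsUnionCyl n A) (hB : IsUnionCyl n B) : IsUnionCyl n (A ∪ B) := by
  obtain ⟨S, rfl⟩ := hA
  obtain ⟨T, rfl⟩ := hB
  refine ⟨S ∪ T, Set.ext fun ω => ?_⟩
  rw [Set.mem_union, mem_iUnion_cyl, mem_iUnion_cyl, mem_iUnion_cyl, Set.mem_union]

/-- An event contains or avoids each cylinder set of its level. -/
theorem cyl_subset_iff (h : IsUnionCyl n A) (c : Node n) : cyl c ⊆ A ↔ c.extend ∈ A := by
  obtain ⟨S, rfl⟩ := h
  rw [cyl_subset_iUnion_iff, mem_iUnion_cyl, c.restrict_extend]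

theorem cyl_subset_iff_parent (h : IsUnionCyl n A) (c : Node (n + 1)) :
    cyl c ⊆ A ↔ cyl c.parent ⊆ A := by
  rw [h.succ.cyl_subset_iff, h.cyl_subset_iff]
  obtain ⟨S, rfl⟩ := h
  rw [mem_iUnion_cyl, mem_iUnion_cyl, c.parent.restrict_extend]
  have : c.extend.restrict n = (c.extend.restrict (n + 1)).parent := rfl
  rw [this, c.restrict_extend]

open Classical in
theorem sum_nodeAmp_succ (t : ℕ → ℂ) (ht : ∀ n, 1 ≤ n → lam t n 0 ≠ 0) (h : IsUnionCyl n A) :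
    (∑ c : Node (n + 1), if cyl c ⊆ A then nodeAmp t c else 0) =
      ∑ c : Node n, if cyl c ⊆ A then nodeAmp t c else 0 := by
  rw [Node.sum_eq_sum_children]
  refine Finset.sum_congr rfl fun c _ => ?_
  rw [Finset.sum_congr rfl fun c' hc' => by
    rw [h.cyl_subset_iff_parent, Node.mem_children.mp hc']]
  split_ifs
  · exact Node.sum_children_nodeAmp t ht c
  · exact Finset.sum_const_zero

open Classical in
/-- The measure of an event may be computed at every sufficiently high level. -/
theorem measure_eq (t : ℕ → ℂ) (ht : ∀ n, 1 ≤ n → lam t n 0 ≠ 0) (h : IsUnionCyl n A) :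
    measure t A = ∑ c : Node n, if cyl c ⊆ A then nodeAmp t c else 0 := by
  have hl : IsUnionCyl (level A) A := Nat.sInf_mem (s := {n | IsUnionCyl n A}) ⟨n, h⟩
  have hle : level A ≤ n := Nat.sInf_le h
  induction n, hle using Nat.le_induction with
  | base => rfl
  | succ m hm ih =>
    rw [sum_nodeAmp_succ t ht (hl.mono hm)]
    exact ih (hl.mono hm)

end IsUnionCyl

/-- Unions of cylinders of a single level are closed under complement, and two levels can be raised
to their maximum. -/
theorem exists_isUnionCyl {A : Set Omega} (hA : A ∈ eventAlgebra) : ∃ n, IsUnionCyl n A := by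
  have h : MeasureTheory.generateSetAlgebra {A | ∃ (n : ℕ) (c : Node n), A = cyl c} A := hA
  induction h with
  | base s hs =>
    obtain ⟨n, c, rfl⟩ := hs
    exact ⟨n, .of_cyl c⟩
  | empty => exact ⟨0, ∅, by simp⟩
  | compl s hs ih =>
    obtain ⟨n, h⟩ := ih hs
    exact ⟨n, h.compl⟩
  | union s t hs ht ihs iht =>
    obtain ⟨n, h⟩ := ihs hs
    obtain ⟨m, h'⟩ := iht ht
    exact ⟨max n m, (h.mono (le_max_left n m)).union (h'.mono (le_max_right n m))⟩

theorem measure_cyl (t : ℕ → ℂ) (ht : ∀ n, 1 ≤ n → lam t n 0 ≠ 0) {n : ℕ} (c : Node n) :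
    measure t (cyl c) = nodeAmp t c := by
  rw [(IsUnionCyl.of_cyl c).measure_eq t ht, Finset.sum_eq_single c]
  · rw [if_pos subset_rfl]
  · intro d _ hd
    rw [if_neg]
    intro h
    exact hd (d.restrict_extend.symm.trans (h d.restrict_extend))
  · exact fun h => absurd (Finset.mem_univ c) h

/-! ### Variation and level sums -/

theorem ofReal_absSum_le_variation (t : ℕ → ℂ) (ht : ∀ n, 1 ≤ n → lam t n 0 ≠ 0) (n : ℕ) :
    ENNReal.ofReal (absSum t n) ≤ variation (measure t) Set.univ := by
  classical
  have hP : IsEventPartition (Finset.univ.image (cyl : Node n → Set Omega)) Set.univ := by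
    refine ⟨fun B hB => ?_, ?_, ?_⟩
    · obtain ⟨c, -, rfl⟩ := Finset.mem_image.mp hB
      exact .base _ ⟨n, c, rfl⟩
    · rw [Finset.coe_image]
      rintro _ ⟨c, -, rfl⟩ _ ⟨d, -, rfl⟩ hcd
      refine Set.disjoint_left.mpr fun ω hc hd => hcd ?_
      rw [← mem_cyl.mp hc, ← mem_cyl.mp hd]
    · refine Set.eq_univ_of_forall fun ω => ⟨cyl (ω.restrict n), ?_, rfl⟩
      simp
  refine le_trans (le_of_eq ?_) (le_iSup₂ (f := fun (P : Finset (Set Omega))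
    (_ : IsEventPartition P Set.univ) => ∑ B ∈ P, ‖measure t B‖ₑ) _ hP)
  rw [Finset.sum_image (cyl_injective n).injOn, absSum,
    ENNReal.ofReal_sum_of_nonneg fun _ _ => norm_nonneg _]
  exact Finset.sum_congr rfl fun c _ => by rw [measure_cyl t ht, ofReal_norm]

theorem variation_le (t : ℕ → ℂ) (ht : ∀ n, 1 ≤ n → lam t n 0 ≠ 0) {K : ℝ}
    (hK : ∀ n, absSum t (n + 1) ≤ K) : variation (measure t) Set.univ ≤ ENNReal.ofReal K := by
  classical
  refine iSup₂_le fun P hP => ?_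
  have hlevel : ∃ n, ∀ B ∈ P, IsUnionCyl n B := by
    choose! f hf using fun B (hB : B ∈ P) => exists_isUnionCyl (hP.1 B hB)
    exact ⟨P.sup f, fun B hB => (hf B hB).mono (Finset.le_sup hB)⟩
  obtain ⟨n, hn⟩ := hlevel
  -- Level `n + 1` is used because `hK` bounds positive levels only.
  have hsum : ∑ B ∈ P, ‖measure t B‖ ≤ absSum t (n + 1) := by
    calc ∑ B ∈ P, ‖measure t B‖
        ≤ ∑ B ∈ P, ∑ c : Node (n + 1), if cyl c ⊆ B then ‖nodeAmp t c‖ else 0 := by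
          refine Finset.sum_le_sum fun B hB => ?_
          rw [(hn B hB).succ.measure_eq t ht]
          refine (norm_sum_le _ _).trans_eq (Finset.sum_congr rfl fun c _ => ?_)
          rw [apply_ite norm, norm_zero]
      _ = ∑ c : Node (n + 1), ∑ B ∈ P, if cyl c ⊆ B then ‖nodeAmp t c‖ else 0 :=
          Finset.sum_comm
      _ ≤ absSum t (n + 1) := by
          refine Finset.sum_le_sum fun c _ => ?_
          rw [← Finset.sum_filter, Finset.sum_const, nsmul_eq_mul]
          refine mul_le_of_le_one_left (norm_nonneg _) ?_
          -- A nonempty cylinder lies in at most one of the disjoint blocks.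
          rw [Nat.cast_le_one, Finset.card_le_one]
          intro B hB C hC
          rw [Finset.mem_filter] at hB hC
          by_contra hBC
          exact Set.disjoint_left.mp (hP.2.1 hB.1 hC.1 hBC)
            (hB.2 c.restrict_extend) (hC.2 c.restrict_extend)
  rw [← Finset.sum_congr rfl fun B _ => ofReal_norm (measure t B),
    ← ENNReal.ofReal_sum_of_nonneg fun _ _ => norm_nonneg _]
  exact ENNReal.ofReal_le_ofReal (hsum.trans (hK n))

theorem hasBoundedVariation_of_seriesConverges (t : ℕ → ℂ) (ht : ∀ n, 1 ≤ n → lam t n 0 ≠ 0)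
    (h : SeriesConverges (zetaA t)) : HasBoundedVariation (measure t) := by
  obtain ⟨l, hl⟩ := h
  refine (variation_le t ht (K := Real.exp l) fun n => ?_).trans_lt ENNReal.ofReal_lt_top
  refine (absSum_le_exp t n).trans (Real.exp_le_exp.mpr ?_)
  exact (monotone_sum_Icc fun n hn => zetaA_nonneg t (ht n hn)).ge_of_tendsto hl n

/-- The terms are nonnegative and the variation bounds the partial sums, which therefore converge to
their supremum. -/
theorem seriesConverges_of_hasBoundedVariation (t : ℕ → ℂ) (ht : ∀ n, 1 ≤ n → lam t n 0 ≠ 0)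
    (h : HasBoundedVariation (measure t)) : SeriesConverges (zetaC t) := by
  refine ⟨_, tendsto_atTop_ciSup (monotone_sum_Icc fun n hn => zetaC_nonneg t (ht n hn)) ?_⟩
  refine ⟨(variation (measure t) Set.univ).toReal, ?_⟩
  rintro _ ⟨N, rfl⟩
  have h1 := (ENNReal.ofReal_le_iff_le_toReal h.ne).mp (ofReal_absSum_le_variation t ht (N + 1))
  have h2 := one_add_sum_le_absSum t ht N
  simp only
  linarith

end CSG

theorem corollary1 (t : ℕ → ℂ) (ht : ∀ n : ℕ, 1 ≤ n → CSG.lam t n 0 ≠ 0) :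
    (∀ n : ℕ, 1 ≤ n →
      CSG.zeta t (CSG.antichain n) = CSG.zetaA t n ∧ CSG.zeta t (CSG.chain n) = CSG.zetaC t n) ∧
    (CSG.SeriesConverges (CSG.zetaA t) → CSG.HasBoundedVariation (CSG.measure t)) ∧
    (¬ CSG.SeriesConverges (CSG.zetaC t) → ¬ CSG.HasBoundedVariation (CSG.measure t)) :=
  ⟨fun n _ => ⟨CSG.Node.zeta_antichain t n, CSG.Node.zeta_chain t n⟩,
    CSG.hasBoundedVariation_of_seriesConverges t ht,
    mt (CSG.seriesConverges_of_hasBoundedVariation t ht)⟩
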